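/- A complete partition of a finite simple graph $G$ is a partition of $V(G)$ into nonempty parts such that there is at least one edge of $G$ between any two distinct parts (edges inside a part are allowed). For an integer $r \ge 1$, let $f(r,C_4)$ be the least $k \in \mathbb{N}$ for which there is a finite simple graph $G$ that contains no (not necessarily induced) $4$-cycle as a subgraph and has a complete partition into exactly $r$ parts, each of size at most $k$. Then $f(r,C_4)$ is well defined for every $r \ge 1$ (such a $k$ exists), and $$f(r,C_4) = r^{1/3} + o(r^{1/3}) \qquad (r \to \infty).$$ -/

import Mathlib

open Filter Asymptotics

/-- A partition `P` of the vertex set of `G` (into nonempty parts) is *complete* if there is at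
least one edge of `G` between any two distinct parts. Edges inside a part are allowed. -/
def IsCompletePartition {V : Type*} [Fintype V] [DecidableEq V] (G : SimpleGraph V)
    (P : Finpartition (Finset.univ : Finset V)) : Prop :=
  ∀ A ∈ P.parts, ∀ B ∈ P.parts, A ≠ B → ∃ a ∈ A, ∃ b ∈ B, G.Adj a b

/-- `G` is an `(r, k)`-graph: it has a complete partition into exactly `r` parts,
each of size at most `k`. -/
def IsRKGraph {V : Type*} [Fintype V] [DecidableEq V] (G : SimpleGraph V) (r k : ℕ) : Prop :=
  ∃ P : Finpartition (Finset.univ : Finset V),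
    IsCompletePartition G P ∧ P.parts.card = r ∧ ∀ A ∈ P.parts, A.card ≤ k

/-- The set of all `k` for which there is an `H`-free `(r, k)`-graph. An `(r, k)`-graph has at most
`r * k` vertices, so up to isomorphism its vertex set is some `Fin n`. `H`-free means that there is
no (not necessarily induced) copy of `H`. -/
def freePartSizes {W : Type*} (r : ℕ) (H : SimpleGraph W) : Set ℕ :=
  {k | ∃ (n : ℕ) (G : SimpleGraph (Fin n)), H.Free G ∧ IsRKGraph G r k}

/-- `f(r, H)`: the least `k` for which there is an `H`-free `(r, k)`-graph. -/
noncomputable def minPartSize {W : Type*} (r : ℕ) (H : SimpleGraph W) : ℕ :=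
  sInf (freePartSizes r H)

open ArithmeticFunction (vonMangoldt)
open scoped Topology

/-! Lower bound. In a `C₄`-free graph two vertices have at most one common neighbour, so `∑ deg² ≤
n² + ∑ deg`, and by Cauchy–Schwarz the degree sum `D` is at most about `n^(3/2)`. A complete
partition forces `D ≥ r(r-1)`, while `n ≤ rk`; hence `r² ≲ (rk)^(3/2)`, that is, `k ≳ r^(1/3)`.

Upper bound. For an odd prime `p`, the symmetric relation `XA = Y + B` between pairs `(X, Y)`, `(A,
B)` over the field with `p²` elements is the incidence relation of an affine plane without its
vertical lines, hence `C₄`-free. Its `p⁴` vertices split into `p³` parts of size `p` so that parts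
with different first coordinates are joined (`HasJoinedBlocks.plane`). The `p²` parts sharing a
first coordinate are joined by a smaller graph on fresh vertices, so `f(p³) ≤ p + f(p²)`. From `f(r)
≤ r`, two rounds give `f(r) = O(r^(4/9))`; in a third round the extra term is `O(p^(8/9)) = o(p)`.

For general `r`, take a prime `p` in `[r^(1/3), (1+ε) r^(1/3)]`. Its existence
(`eventually_exists_prime_between`) follows by the Wiener–Ikehara method: the Fejér average of
`Λ(n)/n^σ` around `log n = y` differs from that of `e^(-(σ-1)v) dv` by an error vanishing as `σ → 1`
and then `y → ∞`. For a narrow kernel most of the average comes from `n` near `e^y`, and proper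
prime powers are negligible. -/

/-! ### `C₄`-free graphs with equal blocks -/

/-- Two distinct vertices have at most one common neighbour. -/
def AtMostOneCommonNeighbor {V : Type*} (G : SimpleGraph V) : Prop :=
  ∀ a b c d, a ≠ c → G.Adj a b → G.Adj b c → G.Adj c d → G.Adj d a → b = d

theorem cycleGraph_four_free_iff {V : Type*} (G : SimpleGraph V) :
    (SimpleGraph.cycleGraph 4).Free G ↔ AtMostOneCommonNeighbor G := by
  constructor
  · intro h a b c d hac hab hbc hcd hda
    by_contra hbd
    refine h ⟨⟨⟨![a, b, c, d], ?_⟩, ?_⟩⟩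
    · intro u v huv
      rw [SimpleGraph.cycleGraph_adj] at huv
      fin_cases u <;> fin_cases v <;>
        first
        | exact absurd huv (by decide)
        | simp [hab, hbc, hcd, hda, hab.symm, hbc.symm, hcd.symm, hda.symm]
    · intro u v huv
      change ![a, b, c, d] u = ![a, b, c, d] v at huv
      have h1 := hab.ne
      have h2 := hbc.ne
      have h3 := hcd.ne
      have h4 := hda.ne
      fin_cases u <;> fin_cases v <;> simp_all
  · rintro h ⟨f⟩
    have hadj : ∀ u v : Fin 4, u - v = 1 ∨ v - u = 1 → G.Adj (f u) (f v) := fun u v huv =>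
      f.toHom.map_rel (SimpleGraph.cycleGraph_adj.2 huv)
    have hne : ∀ u v : Fin 4, u ≠ v → f u ≠ f v := fun u v huv he => huv (f.injective he)
    exact hne 1 3 (by decide) (h (f 0) (f 1) (f 2) (f 3) (hne 0 2 (by decide))
      (hadj _ _ (by decide)) (hadj _ _ (by decide)) (hadj _ _ (by decide)) (hadj _ _ (by decide)))

/-- There is a `C₄`-free graph whose vertex set consists of blocks indexed by `ι`, each a copy of
`κ`, such that any two distinct blocks are joined by an edge. -/
def HasJoinedBlocks (ι κ : Type) : Prop :=
  ∃ G : SimpleGraph (ι × κ), AtMostOneCommonNeighbor G ∧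
    ∀ i j, i ≠ j → ∃ a b, G.Adj (i, a) (j, b)

theorem AtMostOneCommonNeighbor.comap {V W : Type*} {G : SimpleGraph W}
    (h : AtMostOneCommonNeighbor G) {f : V → W} (hf : Function.Injective f) :
    AtMostOneCommonNeighbor (G.comap f) := fun _ _ _ _ hac h1 h2 h3 h4 =>
  hf (h _ _ _ _ (hf.ne hac) h1 h2 h3 h4)

theorem HasJoinedBlocks.of_injective {ι ι' κ : Type} (h : HasJoinedBlocks ι κ) {f : ι' → ι}
    (hf : Function.Injective f) : HasJoinedBlocks ι' κ := by
  obtain ⟨G, hG, hj⟩ := h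
  exact ⟨G.comap (Prod.map f id), hG.comap (hf.prodMap Function.injective_id),
    fun i j hij => hj _ _ (hf.ne hij)⟩

theorem HasJoinedBlocks.congr_right {ι κ κ' : Type} (h : HasJoinedBlocks ι κ) (e : κ' ≃ κ) :
    HasJoinedBlocks ι κ' := by
  obtain ⟨G, hG, hj⟩ := h
  refine ⟨G.comap (Prod.map id e), hG.comap (Function.injective_id.prodMap e.injective),
    fun i j hij => ?_⟩
  obtain ⟨a, b, hab⟩ := hj i j hij
  exact ⟨e.symm a, e.symm b, by simpa using hab⟩

/-- The matching `(i, j) ~ (j, i)` joins blocks `i` and `j`; this trivial bound `f(r) ≤ r` starts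
the recursion. -/
theorem hasJoinedBlocks_self (ι : Type) : HasJoinedBlocks ι ι := by
  refine ⟨⟨fun u v => u ≠ v ∧ v = u.swap, ⟨fun u v h => ⟨h.1.symm, by simp [h.2]⟩⟩,
    ⟨fun u h => h.1 rfl⟩⟩, ?_, fun i j hij => ⟨j, i, by simp [hij], rfl⟩⟩
  intro a b c d hac hab hbc _ _
  exact absurd (by simp [hbc.2, hab.2]) hac

theorem mem_freePartSizes_of_hasJoinedBlocks {r k : ℕ} (hk : 1 ≤ k)
    (h : HasJoinedBlocks (Fin r) (Fin k)) :
    k ∈ freePartSizes r (SimpleGraph.cycleGraph 4) := by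
  obtain ⟨G, hG, hj⟩ := h
  let e : Fin (r * k) ≃ Fin r × Fin k := finProdFinEquiv.symm
  refine ⟨r * k, G.comap e, (cycleGraph_four_free_iff _).2 (hG.comap e.injective), ?_⟩
  let block : Fin r → Finset (Fin (r * k)) := fun i => Finset.univ.filter fun v => (e v).1 = i
  have hmem : ∀ i v, v ∈ block i ↔ (e v).1 = i := fun i v => by simp [block]
  have hinj : Function.Injective block := by
    intro i j hij
    have h1 : e.symm (i, ⟨0, hk⟩) ∈ block j := hij ▸ (hmem _ _).2 (by simp)
    simpa using (hmem _ _).1 h1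
  refine ⟨Finpartition.ofExistsUnique (Finset.univ.image block) (fun _ _ => Finset.subset_univ _)
    ?_ ?_, ?_, ?_, ?_⟩
  · intro v _
    refine ⟨block (e v).1, ⟨by simp, (hmem _ _).2 rfl⟩, ?_⟩
    rintro A ⟨hA, hv⟩
    obtain ⟨i, -, rfl⟩ := Finset.mem_image.1 hA
    rw [(hmem _ _).1 hv]
  · intro h0
    obtain ⟨i, -, hi⟩ := Finset.mem_image.1 h0
    have h1 : e.symm (i, ⟨0, hk⟩) ∈ block i := (hmem _ _).2 (by simp)
    simp [hi] at h1
  · intro A hA B hB hAB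
    obtain ⟨i, -, rfl⟩ := Finset.mem_image.1 hA
    obtain ⟨j, -, rfl⟩ := Finset.mem_image.1 hB
    obtain ⟨a, b, hab⟩ := hj i j (fun h => hAB (h ▸ rfl))
    exact ⟨e.symm (i, a), (hmem _ _).2 (by simp), e.symm (j, b), (hmem _ _).2 (by simp),
      by simpa using hab⟩
  · change (Finset.univ.image block).card = r
    rw [Finset.card_image_of_injective _ hinj, Finset.card_univ, Fintype.card_fin]
  · intro A hA
    obtain ⟨i, -, rfl⟩ := Finset.mem_image.1 hA
    have : (block i).card ≤ (Finset.univ : Finset (Fin k)).card := by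
      refine Finset.card_le_card_of_injOn (fun v => (e v).2) (fun _ _ => by simp) ?_
      intro v hv w hw hvw
      apply e.injective
      rw [Finset.mem_coe, hmem] at hv hw
      exact Prod.ext (hv.trans hw.symm) hvw
    simpa using this

/-! ### The affine plane construction -/

/-- The incidence relation between points and lines of an affine plane over the quadratic extension
`F(√β)`, in coordinates over `F`: `(x₁ + x₂√β)(a₁ + a₂√β) = (s + s') + t (x₁ + √β) + t' (a₁ + √β)`,
where the part of a vertex is `(x₁, x₂, s)` and its label within the part is `t`. -/
def planeRel {F : Type} [Field F] (β : F) (u v : (F × F × F) × F) : Prop :=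
  u.1.2.2 + v.1.2.2 + u.2 * u.1.1 + v.2 * v.1.1 = u.1.1 * v.1.1 + β * (u.1.2.1 * v.1.2.1) ∧
    u.2 + v.2 = u.1.1 * v.1.2.1 + u.1.2.1 * v.1.1

theorem planeRel_symm {F : Type} [Field F] {β : F} {u v : (F × F × F) × F} (h : planeRel β u v) :
    planeRel β v u := by
  obtain ⟨h1, h2⟩ := h
  exact ⟨by linear_combination h1, by linear_combination h2⟩

/-- Adding and subtracting the four incidences gives `(X - X')(A - A') = 0` in the field `F(√β)`, so
one factor vanishes; then the remaining coordinates agree too. -/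
theorem eq_or_eq_of_planeRel {F : Type} [Field F] {β : F} (hβ : ¬ IsSquare β)
    {u v u' v' : (F × F × F) × F} (h1 : planeRel β u v) (h2 : planeRel β u v')
    (h3 : planeRel β u' v) (h4 : planeRel β u' v') : u = u' ∨ v = v' := by
  obtain ⟨⟨x₁, x₂, s⟩, t⟩ := u
  obtain ⟨⟨x₁', x₂', s'⟩, t'⟩ := u'
  obtain ⟨⟨a₁, a₂, b⟩, c⟩ := v
  obtain ⟨⟨a₁', a₂', b'⟩, c'⟩ := v'
  simp only [planeRel] at h1 h2 h3 h4
  -- `e1` and `e2` are the two coordinates of `(X - X')(A - A') = 0`; `e3` is its norm.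
  have e1 : (x₁ - x₁') * (a₁ - a₁') + β * ((x₂ - x₂') * (a₂ - a₂')) = 0 := by
    linear_combination h2.1 + h3.1 - h1.1 - h4.1
  have e2 : (x₁ - x₁') * (a₂ - a₂') + (x₂ - x₂') * (a₁ - a₁') = 0 := by
    linear_combination h2.2 + h3.2 - h1.2 - h4.2
  have key : ∀ x y : F, x ^ 2 - β * y ^ 2 = 0 → x = 0 ∧ y = 0 := by
    intro x y hxy
    have hy : y = 0 := by
      by_contra hy
      refine hβ ⟨x / y, ?_⟩
      field_simp
      linear_combination -hxy
    subst hy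
    exact ⟨by simpa using hxy, rfl⟩
  have e3 : ((x₁ - x₁') ^ 2 - β * (x₂ - x₂') ^ 2) * ((a₁ - a₁') ^ 2 - β * (a₂ - a₂') ^ 2) = 0 := by
    linear_combination ((x₁ - x₁') * (a₁ - a₁') + β * ((x₂ - x₂') * (a₂ - a₂'))) * e1
      - β * ((x₁ - x₁') * (a₂ - a₂') + (x₂ - x₂') * (a₁ - a₁')) * e2
  rcases mul_eq_zero.1 e3 with h | h
  · obtain ⟨hx, hy⟩ := key _ _ h
    left
    obtain rfl := sub_eq_zero.1 hx
    obtain rfl := sub_eq_zero.1 hy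
    have ht : t = t' := by linear_combination h1.2 - h3.2
    subst ht
    have hs : s = s' := by linear_combination h1.1 - h3.1
    subst hs
    rfl
  · obtain ⟨hx, hy⟩ := key _ _ h
    right
    obtain rfl := sub_eq_zero.1 hx
    obtain rfl := sub_eq_zero.1 hy
    have ht : c = c' := by linear_combination h1.2 - h2.2
    subst ht
    have hs : b = b' := by linear_combination h1.1 - h2.1
    subst hs
    rfl

/-- The union of the affine plane graph with copies of `H`, one for each first coordinate. -/
def planeUnion {F κ : Type} [Field F] (β : F) (H : SimpleGraph ((F × F) × κ)) :
    SimpleGraph ((F × F × F) × (F ⊕ κ)) where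
  Adj u v := match u, v with
    | (i, .inl t), (j, .inl t') => (i, t) ≠ (j, t') ∧ planeRel β (i, t) (j, t')
    | (i, .inr l), (j, .inr l') => i.1 = j.1 ∧ H.Adj (i.2, l) (j.2, l')
    | _, _ => False
  symm := by
    constructor
    rintro ⟨i, t | l⟩ ⟨j, t' | l'⟩ h
    · exact ⟨h.1.symm, planeRel_symm h.2⟩
    · exact h
    · exact h
    · exact ⟨h.1.symm, h.2.symm⟩
  loopless := by
    constructor
    rintro ⟨i, t | l⟩ h
    · exact h.1 rfl
    · exact H.irrefl h.2

theorem atMostOneCommonNeighbor_planeUnion {F κ : Type} [Field F] {β : F} (hβ : ¬ IsSquare β)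
    {H : SimpleGraph ((F × F) × κ)} (hH : AtMostOneCommonNeighbor H) :
    AtMostOneCommonNeighbor (planeUnion β H) := by
  rintro ⟨i, t | l⟩ ⟨j, t' | l'⟩ ⟨i', m | m⟩ ⟨j', m' | m'⟩ hac hab hbc hcd hda <;>
    first
    | exact hab.elim
    | exact hbc.elim
    | exact hcd.elim
    | skip
  · rcases eq_or_eq_of_planeRel hβ hab.2 (planeRel_symm hda.2) (planeRel_symm hbc.2) hcd.2 with h | h
    · exact absurd (by simpa using h) hac
    · simpa using h
  · obtain ⟨i₁, i⟩ := i
    obtain ⟨j₁, j⟩ := j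
    obtain ⟨i₁', i'⟩ := i'
    obtain ⟨j₁', j'⟩ := j'
    obtain ⟨rfl, hab⟩ := hab
    obtain ⟨rfl, hbc⟩ := hbc
    obtain ⟨rfl, hcd⟩ := hcd
    obtain ⟨-, hda⟩ := hda
    have := hH _ _ _ _ (fun h => hac (by simpa using h)) hab hbc hcd hda
    simpa using this

/-- Between parts with `x₁ ≠ a₁`, incidence is a linear system in the labels `t, t'` with
determinant `±(x₁ - a₁)`, so an edge exists. Parts with `x₁ = a₁` are joined inside a copy of `H`.
-/
theorem HasJoinedBlocks.plane {F κ : Type} [Field F] {β : F} (hβ : ¬ IsSquare β)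
    (h : HasJoinedBlocks (F × F) κ) : HasJoinedBlocks (F × F × F) (F ⊕ κ) := by
  obtain ⟨H, hH, hj⟩ := h
  refine ⟨planeUnion β H, atMostOneCommonNeighbor_planeUnion hβ hH, ?_⟩
  rintro ⟨x₁, x₂, s⟩ ⟨a₁, a₂, b⟩ hne
  by_cases hx : x₁ = a₁
  · subst hx
    obtain ⟨l, l', hl⟩ := hj (x₂, s) (a₂, b) (fun h => hne (by rw [h]))
    exact ⟨.inr l, .inr l', rfl, hl⟩
  · have hx' : x₁ - a₁ ≠ 0 := sub_ne_zero.2 hx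
    set P := x₁ * a₁ + β * (x₂ * a₂) - s - b with hP
    set Q := x₁ * a₂ + x₂ * a₁ with hQ
    refine ⟨.inl ((P - a₁ * Q) / (x₁ - a₁)), .inl (Q - (P - a₁ * Q) / (x₁ - a₁)),
      fun h => hx (by simp at h; exact h.1.1), ?_, ?_⟩
    · have : (P - a₁ * Q) / (x₁ - a₁) * (x₁ - a₁) = P - a₁ * Q := div_mul_cancel₀ _ hx'
      simp only
      linear_combination this + hP
    · simp only
      linear_combination hQ

theorem HasJoinedBlocks.prime_cube {p k : ℕ} (hp : p.Prime) (hp2 : p ≠ 2)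
    (h : HasJoinedBlocks (Fin (p ^ 2)) (Fin k)) :
    HasJoinedBlocks (Fin (p ^ 3)) (Fin (p + k)) := by
  have := Fact.mk hp
  obtain ⟨β, hβ⟩ := FiniteField.exists_nonsquare (F := ZMod p) (by rwa [ZMod.ringChar_zmod_n])
  have e2 : (ZMod p × ZMod p) ≃ Fin (p ^ 2) :=
    Fintype.equivOfCardEq (by simp [ZMod.card]; ring)
  have e3 : Fin (p ^ 3) ≃ (ZMod p × ZMod p × ZMod p) :=
    Fintype.equivOfCardEq (by simp [ZMod.card]; ring)
  have e1 : Fin (p + k) ≃ ZMod p ⊕ Fin k := Fintype.equivOfCardEq (by simp [ZMod.card])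
  exact (((h.of_injective e2.injective).plane hβ).of_injective e3.injective).congr_right e1

theorem HasJoinedBlocks.mono {r r' : ℕ} {κ : Type} (h : HasJoinedBlocks (Fin r) κ) (hr : r' ≤ r) :
    HasJoinedBlocks (Fin r') κ :=
  h.of_injective (Fin.castLE_injective hr)

/-! ### Counting for the lower bound -/

/-- The left side counts triples `(v, a, b)` with `a, b` adjacent to `v`. If `a ≠ b`, the pair
determines `v`; the triples with `a = b` number `∑ deg`. -/
theorem sum_degree_sq_le {V : Type*} [Fintype V] {G : SimpleGraph V} [DecidableRel G.Adj]
    (hG : AtMostOneCommonNeighbor G) :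
    ∑ v, G.degree v ^ 2 ≤ Fintype.card V ^ 2 + ∑ v, G.degree v := by
  classical
  have h1 : (Finset.univ.sigma fun v => G.neighborFinset v ×ˢ G.neighborFinset v).card =
      ∑ v, G.degree v ^ 2 := by
    simp [Finset.card_sigma, Finset.card_product, sq]
  have h2 : (Finset.univ.sigma fun v => G.neighborFinset v).card = ∑ v, G.degree v := by
    simp [Finset.card_sigma]
  set S := Finset.univ.sigma fun v => G.neighborFinset v ×ˢ G.neighborFinset v with hS
  rw [← h1, ← h2, ← Finset.card_filter_add_card_filter_not (s := S) (fun x => x.2.1 ≠ x.2.2)]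
  apply add_le_add
  · calc (S.filter fun x => x.2.1 ≠ x.2.2).card
        ≤ (Finset.univ : Finset (V × V)).card := by
          refine Finset.card_le_card_of_injOn (fun x => x.2) (fun _ _ => by simp) ?_
          rintro ⟨v, a, b⟩ hv ⟨w, a', b'⟩ hw hvw
          simp only [Prod.mk.injEq] at hvw
          obtain ⟨rfl, rfl⟩ := hvw
          simp [hS] at hv hw
          have := hG a v b w hv.2 hv.1.1.symm hv.1.2 hw.1.2.symm hw.1.1
          subst this
          rfl
      _ = Fintype.card V ^ 2 := by simp [sq]
  · refine Finset.card_le_card_of_injOn (fun x => ⟨x.1, x.2.1⟩) ?_ ?_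
    · rintro ⟨v, a, b⟩ hv
      simp [hS] at hv ⊢
      exact hv.1.1
    · rintro ⟨v, a, b⟩ hv ⟨w, a', b'⟩ hw hvw
      simp [hS] at hv hw hvw
      obtain ⟨rfl, rfl⟩ := hvw
      rw [← hv.2, ← hw.2]

theorem sum_degree_sq_le_card_mul {V : Type*} [Fintype V] {G : SimpleGraph V} [DecidableRel G.Adj]
    (hG : AtMostOneCommonNeighbor G) :
    (∑ v, G.degree v) ^ 2 ≤ Fintype.card V * (Fintype.card V ^ 2 + ∑ v, G.degree v) := by
  have h := sq_sum_le_card_mul_sum_sq (s := Finset.univ) (f := fun v => G.degree v)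
  simp only [Nat.cast_id] at h
  exact h.trans (Nat.mul_le_mul_left _ (sum_degree_sq_le hG))

theorem IsCompletePartition.card_parts_mul_le {V : Type*} [Fintype V] [DecidableEq V]
    {G : SimpleGraph V} [DecidableRel G.Adj] {P : Finpartition (Finset.univ : Finset V)}
    (hP : IsCompletePartition G P) :
    P.parts.card * (P.parts.card - 1) ≤ ∑ v, G.degree v := by
  classical
  have h2 : (Finset.univ.sigma fun v => G.neighborFinset v).card = ∑ v, G.degree v := by
    simp [Finset.card_sigma]
  rw [← h2, Nat.mul_sub_one, ← Finset.offDiag_card]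
  refine Finset.card_le_card_of_surjOn (fun x => (P.part x.1, P.part x.2)) ?_
  rintro ⟨A, B⟩ hAB
  simp at hAB
  obtain ⟨a, ha, b, hb, hab⟩ := hP A hAB.1 B hAB.2.1 hAB.2.2
  refine ⟨⟨a, b⟩, by simpa using hab, ?_⟩
  simp only [Prod.mk.injEq]
  exact ⟨P.part_eq_of_mem hAB.1 ha, P.part_eq_of_mem hAB.2.1 hb⟩

/-- The counting bound for a `C₄`-free `(r, k)`-graph. -/
theorem exists_counting_of_mem_freePartSizes {r k : ℕ}
    (h : k ∈ freePartSizes r (SimpleGraph.cycleGraph 4)) :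
    ∃ n D : ℕ, n ≤ r * k ∧ r * (r - 1) ≤ D ∧ D ^ 2 ≤ n * (n ^ 2 + D) := by
  classical
  obtain ⟨n, G, hG, P, hP, hr, hk⟩ := h
  refine ⟨n, ∑ v, G.degree v, ?_, hr ▸ hP.card_parts_mul_le, ?_⟩
  · have := P.sum_card_parts
    rw [Finset.card_univ, Fintype.card_fin] at this
    rw [← this, ← hr]
    simpa using Finset.sum_le_card_nsmul _ _ k hk
  · simpa using sum_degree_sq_le_card_mul ((cycleGraph_four_free_iff G).1 hG)

/-! ### The Fejér kernel -/

/-- The Fejér kernel. -/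
noncomputable def fejer (l u : ℝ) : ℝ := l * Real.sinc (l * u / 2) ^ 2

theorem fejer_nonneg {l : ℝ} (hl : 0 ≤ l) (u : ℝ) : 0 ≤ fejer l u :=
  mul_nonneg hl (sq_nonneg _)

theorem fejer_le {l : ℝ} (hl : 0 ≤ l) (u : ℝ) : fejer l u ≤ l :=
  mul_le_of_le_one_right hl (by
    rw [sq_le_one_iff_abs_le_one]
    exact abs_le.2 ⟨Real.neg_one_le_sinc _, Real.sinc_le_one _⟩)

theorem continuous_fejer (l : ℝ) : Continuous (fejer l) := by
  unfold fejer
  have := Real.continuous_sinc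
  fun_prop

theorem fejer_eq_of_ne {l u : ℝ} (hl : l ≠ 0) (hu : u ≠ 0) :
    fejer l u = 4 * Real.sin (l * u / 2) ^ 2 / (l * u ^ 2) := by
  rw [fejer, Real.sinc_of_ne_zero (by positivity)]
  field_simp
  ring

theorem fejer_eq_integral {l : ℝ} (hl : 0 < l) (u : ℝ) :
    fejer l u = ∫ t in (0 : ℝ)..l, 2 * (1 - t / l) * Real.cos (t * u) := by
  have hl' := hl.ne'
  rcases eq_or_ne u 0 with rfl | hu
  · have h : ∀ t ∈ Set.uIcc 0 l, HasDerivAt (fun t : ℝ => 2 * t - t ^ 2 / l)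
        (2 * (1 - t / l) * Real.cos (t * 0)) t := by
      intro t _
      have := ((hasDerivAt_id t).const_mul 2).sub (((hasDerivAt_id t).pow 2).div_const l)
      refine HasDerivAt.congr_deriv this ?_
      simp
      ring
    rw [intervalIntegral.integral_eq_sub_of_hasDerivAt h
      (Continuous.intervalIntegrable (by fun_prop) _ _)]
    simp [fejer]
    field_simp
    ring
  · have h : ∀ t ∈ Set.uIcc 0 l, HasDerivAt
        (fun t : ℝ => 2 * ((1 - t / l) * (Real.sin (t * u) / u) - Real.cos (t * u) / (l * u ^ 2)))
        (2 * (1 - t / l) * Real.cos (t * u)) t := by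
      intro t _
      have h1 : HasDerivAt (fun t : ℝ => t * u) u t := by
        simpa using (hasDerivAt_id t).mul_const u
      have h2 : HasDerivAt (fun t : ℝ => 1 - t / l) (-(1 / l)) t := by
        simpa using ((hasDerivAt_id t).div_const l).const_sub 1
      have := ((h2.mul (h1.sin.div_const u)).sub (h1.cos.div_const (l * u ^ 2))).const_mul 2
      refine HasDerivAt.congr_deriv this ?_
      field_simp
      ring
    rw [intervalIntegral.integral_eq_sub_of_hasDerivAt h
      (Continuous.intervalIntegrable (by fun_prop) _ _), fejer_eq_of_ne hl' hu,
      Real.sin_sq_eq_half_sub]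
    rw [show 2 * (l * u / 2) = l * u by ring]
    simp
    field_simp
    ring

theorem fejer_le_div {l u : ℝ} (hl : 0 < l) (hu : u ≠ 0) : fejer l u ≤ 4 / (l * u ^ 2) := by
  rw [fejer_eq_of_ne hl.ne' hu]
  gcongr
  nlinarith [Real.sin_sq_le_one (l * u / 2)]

/-- For `t ≤ l` the bound `|tu| ≤ 1` gives `cos (tu) ≥ 1/2` in the integral formula. -/
theorem half_le_fejer {l u : ℝ} (hl : 0 < l) (hu : l * |u| ≤ 1) : l / 2 ≤ fejer l u := by
  have h1 : l / 2 = ∫ t in (0 : ℝ)..l, (1 - t / l) := by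
    have h : ∀ t ∈ Set.uIcc 0 l, HasDerivAt (fun t : ℝ => t - t ^ 2 / (2 * l)) (1 - t / l) t := by
      intro t _
      have := (hasDerivAt_id t).sub (((hasDerivAt_id t).pow 2).div_const (2 * l))
      refine HasDerivAt.congr_deriv this ?_
      simp
      field_simp
    rw [intervalIntegral.integral_eq_sub_of_hasDerivAt h
      (Continuous.intervalIntegrable (by fun_prop) _ _)]
    field_simp
    ring
  rw [h1, fejer_eq_integral hl]
  refine intervalIntegral.integral_mono_on hl.le (Continuous.intervalIntegrable (by fun_prop) _ _)
    (Continuous.intervalIntegrable (by fun_prop) _ _) ?_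
  intro t ht
  have h2 : t / l ≤ 1 := div_le_one_of_le₀ ht.2 hl.le
  have h3 := Real.one_sub_sq_div_two_le_cos (x := t * u)
  have h4 : (t * u) ^ 2 ≤ 1 := by
    rw [sq_le_one_iff_abs_le_one, abs_mul, abs_of_nonneg ht.1]
    exact (mul_le_mul_of_nonneg_right ht.2 (abs_nonneg u)).trans hu
  nlinarith

theorem fejer_one_le (u : ℝ) : fejer 1 u ≤ 5 * (1 + u ^ 2)⁻¹ := by
  rcases le_total (u ^ 2) 4 with h | h
  · refine (fejer_le zero_le_one u).trans ?_
    rw [← div_eq_mul_inv, le_div_iff₀ (by positivity)]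
    linarith
  · have hu : u ≠ 0 := by rintro rfl; norm_num at h
    refine (fejer_le_div one_pos hu).trans ?_
    rw [← div_eq_mul_inv, div_le_div_iff₀ (by positivity) (by positivity)]
    linarith

theorem integrable_fejer_one : MeasureTheory.Integrable (fejer 1) := by
  refine (integrable_inv_one_add_sq.const_mul 5).mono' (continuous_fejer 1).aestronglyMeasurable ?_
  filter_upwards with u
  rw [Real.norm_of_nonneg (fejer_nonneg zero_le_one u)]
  exact fejer_one_le u

/-- One kernel has zeros, but its shift by `π` turns `sin²` into `cos²`, so the sum of the two
dominates a zero-free weight of quadratic decay. -/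
theorem inv_abs_add_pi_sq_le (u : ℝ) :
    1 / (|u| + Real.pi) ^ 2 ≤ fejer 1 u + fejer 1 (u + Real.pi) := by
  have hpi := Real.pi_gt_three
  have key : ∀ v w : ℝ, |v| ≤ |u| + Real.pi →
      4 * w ^ 2 / (|u| + Real.pi) ^ 2 ≤ 4 * w ^ 2 / v ^ 2 ∨ v = 0 := by
    intro v w hv
    rcases eq_or_ne v 0 with h | h
    · exact .inr h
    · left
      gcongr 4 * w ^ 2 / ?_
      rw [← sq_abs v]
      gcongr
  have low : ∀ v : ℝ, |v| ≤ |u| + Real.pi →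
      4 * Real.sin (v / 2) ^ 2 / (|u| + Real.pi) ^ 2 ≤ fejer 1 v := by
    intro v hv
    rcases eq_or_ne v 0 with rfl | h
    · simpa using fejer_nonneg zero_le_one 0
    · rw [fejer_eq_of_ne one_ne_zero h]
      simp only [one_mul]
      exact (key v _ hv).resolve_right h
  have h1 := low u (by linarith)
  have h2 := low (u + Real.pi) ((abs_add_le _ _).trans (by rw [abs_of_pos Real.pi_pos]))
  rw [show (u + Real.pi) / 2 = u / 2 + Real.pi / 2 by ring, Real.sin_add_pi_div_two] at h2
  have h3 : 1 / (|u| + Real.pi) ^ 2 ≤ 4 * Real.sin (u / 2) ^ 2 / (|u| + Real.pi) ^ 2 +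
      4 * Real.cos (u / 2) ^ 2 / (|u| + Real.pi) ^ 2 := by
    rw [← add_div]
    gcongr
    nlinarith [Real.sin_sq_add_cos_sq (u / 2)]
  linarith

open MeasureTheory in
/-- Averaging the Fejér kernel against an integrable weight, in terms of the Fourier transform of
the weight. -/
theorem integral_mul_fejer {l : ℝ} (hl : 0 < l) {X : Type*} [MeasurableSpace X] {μ : Measure X}
    [SFinite μ] {w φ : X → ℝ} (hw : Integrable w μ) (hφ : Measurable φ) (y : ℝ) :
    ∫ x, w x * fejer l (φ x - y) ∂μ =
      (∫ t in (0 : ℝ)..l, ((2 * (1 - t / l) : ℝ) : ℂ) * Complex.exp (t * y * Complex.I) *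
        ∫ x, (w x : ℂ) * Complex.exp (-(t * φ x * Complex.I)) ∂μ).re := by
  set F : X → ℝ → ℂ := fun x t => (w x : ℂ) *
    (((2 * (1 - t / l) : ℝ) : ℂ) * Complex.exp ((t * (y - φ x) : ℝ) * Complex.I)) with hF
  have hint : Integrable (Function.uncurry F) (μ.prod (volume.restrict (Set.Ioc 0 l))) := by
    have h1 : Integrable (fun p : X × ℝ => w p.1 * 2) (μ.prod (volume.restrict (Set.Ioc 0 l))) :=
      hw.mul_prod (integrable_const (2 : ℝ))
    have h2 : AEStronglyMeasurable (fun p : X × ℝ => (w p.1 : ℂ))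
        (μ.prod (volume.restrict (Set.Ioc 0 l))) :=
      (Complex.continuous_ofReal.comp_aestronglyMeasurable hw.1).comp_fst
    have hbound : ∀ᵐ t ∂(volume.restrict (Set.Ioc 0 l)), |2 * (1 - t / l)| ≤ 2 := by
      filter_upwards [ae_restrict_mem measurableSet_Ioc] with t ht
      have h3 : t / l ≤ 1 := div_le_one_of_le₀ ht.2 hl.le
      have h4 : 0 ≤ t / l := div_nonneg ht.1.le hl.le
      rw [abs_le]
      constructor <;> linarith
    have hbound' : ∀ᵐ p ∂(μ.prod (volume.restrict (Set.Ioc 0 l))), |2 * (1 - p.2 / l)| ≤ 2 :=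
      Measure.quasiMeasurePreserving_snd.ae hbound
    refine h1.mono (h2.mul (Measurable.aestronglyMeasurable (by fun_prop))) ?_
    filter_upwards [hbound'] with p hp
    simp only [Function.uncurry, hF]
    rw [norm_mul, norm_mul, Complex.norm_exp_ofReal_mul_I, mul_one, norm_mul, Complex.norm_real,
      Complex.norm_real]
    gcongr
    simpa using hp
  have hswap := integral_integral_swap hint
  have hinner : ∀ x, ∫ t in Set.Ioc 0 l, F x t =
      (w x : ℂ) * ∫ t in Set.Ioc 0 l,
        (((2 * (1 - t / l) : ℝ) : ℂ) * Complex.exp ((t * (y - φ x) : ℝ) * Complex.I)) := fun x =>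
    integral_const_mul _ _
  have hcont : ∀ x, IntegrableOn (fun t : ℝ => (((2 * (1 - t / l) : ℝ) : ℂ) *
      Complex.exp ((t * (y - φ x) : ℝ) * Complex.I))) (Set.Ioc 0 l) := fun x =>
    (Continuous.integrableOn_Icc (by fun_prop)).mono_set Set.Ioc_subset_Icc_self
  have hre : ∀ x, (∫ t in Set.Ioc 0 l, F x t).re = w x * fejer l (φ x - y) := by
    intro x
    rw [hinner, Complex.re_ofReal_mul]
    congr 1
    have := integral_re (𝕜 := ℂ) (hcont x)
    simp only [RCLike.re_to_complex] at this
    rw [← this, fejer_eq_integral hl, intervalIntegral.integral_of_le hl.le]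
    refine integral_congr_ae (ae_of_all _ fun t => ?_)
    simp only
    rw [Complex.re_ofReal_mul, Complex.exp_ofReal_mul_I_re]
    congr 1
    rw [← Real.cos_neg]
    congr 1
    ring
  have hout : ∀ t : ℝ, ∫ x, F x t ∂μ = ((2 * (1 - t / l) : ℝ) : ℂ) *
      Complex.exp (t * y * Complex.I) *
        ∫ x, (w x : ℂ) * Complex.exp (-(t * φ x * Complex.I)) ∂μ := by
    intro t
    rw [← integral_const_mul]
    refine integral_congr_ae (ae_of_all _ fun x => ?_)
    simp only [hF]
    rw [show ((t * (y - φ x) : ℝ) : ℂ) * Complex.I = t * y * Complex.I + -(t * φ x * Complex.I) by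
      push_cast; ring, Complex.exp_add]
    ring
  have hX := integral_re (𝕜 := ℂ) hint.integral_prod_left
  simp only [RCLike.re_to_complex, Function.uncurry] at hX
  simp_rw [hre] at hX
  rw [hX, hswap, intervalIntegral.integral_of_le hl.le]
  simp_rw [hout]

/-! ### Smoothed sums of the von Mangoldt function -/

/-- The continuous extension of `-ζ'/ζ(s) - 1/(s-1)` to the closed half plane `1 ≤ re s`. -/
noncomputable def vonMangoldtAux (s : ℂ) : ℂ :=
  ArithmeticFunction.vonMangoldt.LFunctionResidueClassAux (1 : ZMod 1) s

theorem residueClass_one_eq (n : ℕ) :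
    ArithmeticFunction.vonMangoldt.residueClass (1 : ZMod 1) n = vonMangoldt n := by
  simp [ArithmeticFunction.vonMangoldt.residueClass, Subsingleton.elim (n : ZMod 1) 1]

theorem continuousOn_vonMangoldtAux : ContinuousOn vonMangoldtAux {s | 1 ≤ s.re} :=
  ArithmeticFunction.vonMangoldt.continuousOn_LFunctionResidueClassAux 1

theorem vonMangoldtAux_eq {s : ℂ} (hs : 1 < s.re) :
    vonMangoldtAux s = LSeries (fun n => (vonMangoldt n : ℂ)) s - 1 / (s - 1) := by
  have h := ArithmeticFunction.vonMangoldt.eqOn_LFunctionResidueClassAux (q := 1) (a := 1)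
    isUnit_one hs
  simpa [residueClass_one_eq, vonMangoldtAux] using h

theorem summable_vonMangoldt_div_rpow {σ : ℝ} (hσ : 1 < σ) :
    Summable fun n : ℕ => vonMangoldt n / (n : ℝ) ^ σ := by
  have h := (ArithmeticFunction.LSeriesSummable_vonMangoldt (s := σ) (by simpa)).norm
  refine h.congr fun n => ?_
  rcases eq_or_ne n 0 with rfl | hn
  · simp
  · rw [LSeries.term_of_ne_zero hn, norm_div, Complex.norm_real,
      Real.norm_of_nonneg ArithmeticFunction.vonMangoldt_nonneg,
      Complex.norm_natCast_cpow_of_pos (Nat.pos_of_ne_zero hn), Complex.ofReal_re]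

theorem continuousOn_vonMangoldtAux_line {σ l : ℝ} (hσ : 1 ≤ σ) :
    ContinuousOn (fun t : ℝ => vonMangoldtAux (σ + t * Complex.I)) (Set.Icc 0 l) :=
  continuousOn_vonMangoldtAux.comp (Continuous.continuousOn (by fun_prop))
    (fun t _ => by simpa using hσ)

theorem exists_norm_vonMangoldtAux_le (l : ℝ) :
    ∃ M, ∀ σ ∈ Set.Icc (1 : ℝ) 2, ∀ t ∈ Set.Icc 0 l, ‖vonMangoldtAux (σ + t * Complex.I)‖ ≤ M := by
  have h : ContinuousOn (fun p : ℝ × ℝ => vonMangoldtAux (p.1 + p.2 * Complex.I))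
      (Set.Icc 1 2 ×ˢ Set.Icc 0 l) :=
    continuousOn_vonMangoldtAux.comp (Continuous.continuousOn (by fun_prop))
      (fun p hp => by simpa using hp.1.1)
  obtain ⟨M, hM⟩ := (isCompact_Icc.prod isCompact_Icc).exists_bound_of_continuousOn h
  exact ⟨M, fun σ hσ t ht => hM (σ, t) ⟨hσ, ht⟩⟩

/-- The Fejér-weighted Fourier integral of `vonMangoldtAux` on the line `re s = σ`. -/
noncomputable def smoothedAux (l σ y : ℝ) : ℂ :=
  ∫ t in (0 : ℝ)..l, ((2 * (1 - t / l) : ℝ) : ℂ) * Complex.exp (t * y * Complex.I) *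
    vonMangoldtAux (σ + t * Complex.I)

theorem tsum_vonMangoldt_mul_fejer {l σ : ℝ} (hl : 0 < l) (hσ : 1 < σ) (y : ℝ) :
    ∑' n : ℕ, vonMangoldt n / (n : ℝ) ^ σ * fejer l (Real.log n - y) =
      (∫ t in (0 : ℝ)..l, ((2 * (1 - t / l) : ℝ) : ℂ) * Complex.exp (t * y * Complex.I) *
        LSeries (fun n => (vonMangoldt n : ℂ)) (σ + t * Complex.I)).re := by
  have hw : MeasureTheory.Integrable (fun n : ℕ => vonMangoldt n / (n : ℝ) ^ σ)
      MeasureTheory.Measure.count :=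
    MeasureTheory.integrable_count_iff.2 (summable_vonMangoldt_div_rpow hσ).norm
  have h := integral_mul_fejer hl hw (φ := fun n : ℕ => Real.log n) measurable_from_top y
  rw [MeasureTheory.integral_countable] at h
  · simp only [MeasureTheory.measureReal_def, MeasureTheory.Measure.count_singleton,
      ENNReal.toReal_one, one_smul] at h
    rw [h]
    congr 1
    refine intervalIntegral.integral_congr fun t _ => ?_
    congr 1
    rw [MeasureTheory.integral_countable]
    · simp only [MeasureTheory.measureReal_def, MeasureTheory.Measure.count_singleton,
        ENNReal.toReal_one, one_smul]
      refine tsum_congr fun n => ?_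
      rcases eq_or_ne n 0 with rfl | hn
      · simp
      · have hn' : (n : ℂ) ≠ 0 := Nat.cast_ne_zero.2 hn
        rw [LSeries.term_of_ne_zero hn, Complex.cpow_add _ _ hn', Complex.exp_neg,
          Complex.cpow_def_of_ne_zero hn' (t * Complex.I)]
        rw [Complex.natCast_log, Complex.ofReal_div, Complex.ofReal_cpow (Nat.cast_nonneg n),
          Complex.ofReal_natCast, div_eq_mul_inv, div_eq_mul_inv, mul_inv, mul_assoc]
        congr 4
        ring
    · refine hw.norm.mono' (measurable_from_top.aestronglyMeasurable)
        (MeasureTheory.ae_of_all _ fun n => ?_)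
      rw [norm_mul, Complex.norm_real, show -((t : ℂ) * (Real.log n : ℝ) * Complex.I) =
        ((-(t * Real.log n) : ℝ) : ℂ) * Complex.I by push_cast; ring,
        Complex.norm_exp_ofReal_mul_I, mul_one]
  · refine (hw.norm.mul_const l).mono' (measurable_from_top.aestronglyMeasurable)
      (MeasureTheory.ae_of_all _ fun n => ?_)
    rw [norm_mul, Real.norm_of_nonneg (fejer_nonneg hl.le _)]
    gcongr
    exact fejer_le hl.le _

theorem integral_exp_mul_fejer {l σ : ℝ} (hl : 0 < l) (hσ : 1 < σ) (y : ℝ) :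
    ∫ v in Set.Ioi 0, Real.exp (-(σ - 1) * v) * fejer l (v - y) =
      (∫ t in (0 : ℝ)..l, ((2 * (1 - t / l) : ℝ) : ℂ) * Complex.exp (t * y * Complex.I) *
        (1 / (σ + t * Complex.I - 1))).re := by
  have hw : MeasureTheory.IntegrableOn (fun v : ℝ => Real.exp (-(σ - 1) * v)) (Set.Ioi 0) :=
    exp_neg_integrableOn_Ioi 0 (by linarith)
  rw [integral_mul_fejer hl hw (φ := fun v => v) measurable_id y]
  congr 1
  refine intervalIntegral.integral_congr fun t _ => ?_
  congr 1
  have h := integral_exp_mul_complex_Ioi (a := -(σ - 1 + t * Complex.I)) (by simpa using hσ) 0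
  rw [show (σ : ℂ) + t * Complex.I - 1 = σ - 1 + t * Complex.I by ring]
  simp only [Complex.ofReal_zero, mul_zero, Complex.exp_zero, div_neg, neg_div, neg_neg] at h
  rw [← h]
  refine MeasureTheory.integral_congr_ae (MeasureTheory.ae_of_all _ fun v => ?_)
  simp only
  rw [Complex.ofReal_exp, ← Complex.exp_add]
  congr 1
  push_cast
  ring

/-- On the line `re s = σ`, the Dirichlet series of `Λ` is `1/(s-1)` plus `vonMangoldtAux`; the pole
transforms back to the exponential integral, the main term. -/
theorem tsum_sub_integral_eq_smoothedAux {l σ : ℝ} (hl : 0 < l) (hσ : 1 < σ) (y : ℝ) :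
    ∑' n : ℕ, vonMangoldt n / (n : ℝ) ^ σ * fejer l (Real.log n - y) =
      (∫ v in Set.Ioi 0, Real.exp (-(σ - 1) * v) * fejer l (v - y)) + (smoothedAux l σ y).re := by
  have hI : ∀ f : ℝ → ℂ, ContinuousOn f (Set.Icc 0 l) → IntervalIntegrable
      (fun t : ℝ => ((2 * (1 - t / l) : ℝ) : ℂ) * Complex.exp (t * y * Complex.I) * f t)
      MeasureTheory.volume 0 l := by
    intro f hf
    refine ContinuousOn.intervalIntegrable ?_
    rw [Set.uIcc_of_le hl.le]
    exact (Continuous.continuousOn (by fun_prop)).mul hf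
  have hne : ∀ t : ℝ, (σ : ℂ) + t * Complex.I - 1 ≠ 0 := by
    intro t h
    have := congrArg Complex.re h
    simp at this
    linarith
  rw [tsum_vonMangoldt_mul_fejer hl hσ, integral_exp_mul_fejer hl hσ, smoothedAux, ← Complex.add_re,
    ← intervalIntegral.integral_add (hI (fun t => 1 / (σ + t * Complex.I - 1))
      (continuousOn_const.div (Continuous.continuousOn (by fun_prop)) fun t _ => hne t))
      (hI _ (continuousOn_vonMangoldtAux_line hσ.le))]
  congr 1
  refine intervalIntegral.integral_congr fun t _ => ?_
  rw [vonMangoldtAux_eq (by simpa using hσ)]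
  ring

theorem norm_weight_le {l t : ℝ} (hl : 0 < l) (ht : t ∈ Set.Icc 0 l) (y : ℝ) :
    ‖((2 * (1 - t / l) : ℝ) : ℂ) * Complex.exp (t * y * Complex.I)‖ ≤ 2 := by
  have h3 : t / l ≤ 1 := div_le_one_of_le₀ ht.2 hl.le
  have h4 : 0 ≤ t / l := div_nonneg ht.1 hl.le
  rw [norm_mul, Complex.norm_real, ← Complex.ofReal_mul, Complex.norm_exp_ofReal_mul_I, mul_one,
    Real.norm_of_nonneg (by linarith)]
  linarith

theorem exists_norm_smoothedAux_le {l : ℝ} (hl : 0 < l) :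
    ∃ M, ∀ σ ∈ Set.Icc (1 : ℝ) 2, ∀ y, ‖smoothedAux l σ y‖ ≤ M := by
  obtain ⟨M, hM⟩ := exists_norm_vonMangoldtAux_le l
  refine ⟨2 * M * |l - 0|, fun σ hσ y => ?_⟩
  refine intervalIntegral.norm_integral_le_of_norm_le_const fun t ht => ?_
  rw [Set.uIoc_of_le hl.le] at ht
  have ht' := Set.Ioc_subset_Icc_self ht
  rw [norm_mul]
  exact mul_le_mul (norm_weight_le hl ht' y) (hM σ hσ t ht') (norm_nonneg _) zero_le_two

theorem tendsto_smoothedAux_one {l : ℝ} (hl : 0 < l) (y : ℝ) :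
    Tendsto (fun σ => smoothedAux l σ y) (𝓝[>] 1) (𝓝 (smoothedAux l 1 y)) := by
  obtain ⟨M, hM⟩ := exists_norm_vonMangoldtAux_le l
  have hev : ∀ᶠ σ : ℝ in 𝓝[>] 1, σ ∈ Set.Icc (1 : ℝ) 2 := by
    filter_upwards [Ioc_mem_nhdsGT (one_lt_two (α := ℝ))] with σ hσ
    exact Set.Ioc_subset_Icc_self hσ
  refine intervalIntegral.tendsto_integral_filter_of_dominated_convergence (fun _ => 2 * M) ?_ ?_
    intervalIntegrable_const ?_
  · filter_upwards [hev] with σ hσ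
    rw [Set.uIoc_of_le hl.le]
    refine ContinuousOn.aestronglyMeasurable ?_ measurableSet_Ioc
    exact (Continuous.continuousOn (by fun_prop)).mul
      ((continuousOn_vonMangoldtAux_line hσ.1).mono Set.Ioc_subset_Icc_self)
  · filter_upwards [hev] with σ hσ
    refine MeasureTheory.ae_of_all _ fun t ht => ?_
    rw [Set.uIoc_of_le hl.le] at ht
    have ht' := Set.Ioc_subset_Icc_self ht
    rw [norm_mul]
    exact mul_le_mul (norm_weight_le hl ht' y) (hM σ hσ t ht') (norm_nonneg _) zero_le_two
  · refine MeasureTheory.ae_of_all _ fun t _ => Tendsto.const_mul _ ?_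
    have h := continuousOn_vonMangoldtAux ((1 : ℝ) + t * Complex.I) (by simp)
    refine h.tendsto.comp (tendsto_nhdsWithin_iff.2 ⟨?_, ?_⟩)
    · refine Tendsto.mono_left ?_ nhdsWithin_le_nhds
      exact Continuous.tendsto (by fun_prop : Continuous fun σ : ℝ => (σ : ℂ) + t * Complex.I) 1
    · filter_upwards [hev] with σ hσ
      simpa using hσ.1

/-- Riemann–Lebesgue lemma, usable on the line `re s = 1` itself; the factor `-1/(2π)` matches the
Fourier normalisation. -/
theorem tendsto_smoothedAux_atTop {l : ℝ} (hl : 0 < l) :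
    Tendsto (fun y => smoothedAux l 1 y) atTop (𝓝 0) := by
  have h := Real.tendsto_integral_exp_smul_cocompact (Set.indicator (Set.Ioc 0 l) fun t : ℝ =>
    ((2 * (1 - t / l) : ℝ) : ℂ) * vonMangoldtAux ((1 : ℝ) + t * Complex.I))
  have h2 : Tendsto (fun y : ℝ => -(y / (2 * Real.pi))) atTop (cocompact ℝ) :=
    (tendsto_neg_atTop_atBot.comp (tendsto_id.atTop_div_const (by positivity))).mono_right
      atBot_le_cocompact
  refine (h.comp h2).congr fun y => ?_
  simp only [Function.comp, smoothedAux]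
  rw [intervalIntegral.integral_of_le hl.le, ← MeasureTheory.integral_indicator measurableSet_Ioc]
  refine MeasureTheory.integral_congr_ae (MeasureTheory.ae_of_all _ fun t => ?_)
  simp only
  by_cases ht : t ∈ Set.Ioc 0 l
  swap
  · simp [ht]
  rw [Set.indicator_of_mem ht, Set.indicator_of_mem ht, Circle.smul_def,
    Real.fourierChar_apply, smul_eq_mul]
  rw [show 2 * Real.pi * (-(t * -(y / (2 * Real.pi)))) = t * y by field_simp]
  push_cast
  ring

theorem summable_vonMangoldt_mul_fejer {l σ : ℝ} (hl : 0 < l) (hσ : 1 < σ) (y : ℝ) :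
    Summable fun n : ℕ => vonMangoldt n / (n : ℝ) ^ σ * fejer l (Real.log n - y) := by
  refine Summable.of_nonneg_of_le (fun n => ?_) (fun n => ?_)
    ((summable_vonMangoldt_div_rpow hσ).mul_right l)
  · exact mul_nonneg (div_nonneg ArithmeticFunction.vonMangoldt_nonneg (by positivity))
      (fejer_nonneg hl.le _)
  · exact mul_le_mul_of_nonneg_left (fejer_le hl.le _)
      (div_nonneg ArithmeticFunction.vonMangoldt_nonneg (by positivity))

theorem exists_tsum_fejer_one_le :
    ∃ C, ∀ σ ∈ Set.Ioc (1 : ℝ) 2, ∀ y,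
      ∑' n : ℕ, vonMangoldt n / (n : ℝ) ^ σ * fejer 1 (Real.log n - y) ≤ C := by
  obtain ⟨M, hM⟩ := exists_norm_smoothedAux_le one_pos
  refine ⟨(∫ v, fejer 1 v) + M, fun σ hσ y => ?_⟩
  rw [tsum_sub_integral_eq_smoothedAux one_pos hσ.1]
  refine add_le_add ?_ ((Complex.re_le_norm _).trans (hM σ (Set.Ioc_subset_Icc_self hσ) y))
  have hint : MeasureTheory.Integrable fun v => fejer 1 (v - y) :=
    integrable_fejer_one.comp_sub_right y
  calc ∫ v in Set.Ioi 0, Real.exp (-(σ - 1) * v) * fejer 1 (v - y)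
      ≤ ∫ v in Set.Ioi 0, fejer 1 (v - y) := by
        refine MeasureTheory.integral_mono_of_nonneg (MeasureTheory.ae_of_all _ fun v => ?_)
          hint.integrableOn ?_
        · exact mul_nonneg (Real.exp_nonneg _) (fejer_nonneg zero_le_one _)
        · filter_upwards [MeasureTheory.ae_restrict_mem measurableSet_Ioi] with v hv
          refine mul_le_of_le_one_left (fejer_nonneg zero_le_one _) (Real.exp_le_one_iff.2 ?_)
          have : 0 < v := hv
          nlinarith [hσ.1]
    _ ≤ ∫ v, fejer 1 (v - y) :=
        MeasureTheory.setIntegral_le_integral hint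
          (MeasureTheory.ae_of_all _ fun v => fejer_nonneg zero_le_one _)
    _ = ∫ v, fejer 1 v := MeasureTheory.integral_sub_right_eq_self _ y

/-- Fejér sums of width one, centred at `y` and `y - π`, dominate this sum. The uniformity in `σ`
and `y` controls the kernel's tails. -/
theorem exists_tsum_inv_sq_le :
    ∃ C, 0 ≤ C ∧ ∀ σ ∈ Set.Ioc (1 : ℝ) 2, ∀ y,
      Summable (fun n : ℕ => vonMangoldt n / (n : ℝ) ^ σ *
        (1 / (|Real.log n - y| + Real.pi) ^ 2)) ∧
      ∑' n : ℕ, vonMangoldt n / (n : ℝ) ^ σ * (1 / (|Real.log n - y| + Real.pi) ^ 2) ≤ C := by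
  obtain ⟨C, hC⟩ := exists_tsum_fejer_one_le
  have hw : ∀ (σ : ℝ) (n : ℕ), 0 ≤ vonMangoldt n / (n : ℝ) ^ σ := fun σ n =>
    div_nonneg ArithmeticFunction.vonMangoldt_nonneg (by positivity)
  have hC0 : 0 ≤ C := le_trans
    (tsum_nonneg fun n => mul_nonneg (hw 2 n) (fejer_nonneg zero_le_one _))
    (hC 2 (by norm_num) 0)
  refine ⟨C + C, by linarith, fun σ hσ y => ?_⟩
  have h1 := summable_vonMangoldt_mul_fejer one_pos hσ.1 y
  have h2 := summable_vonMangoldt_mul_fejer one_pos hσ.1 (y - Real.pi)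
  have hle : ∀ n : ℕ, vonMangoldt n / (n : ℝ) ^ σ * (1 / (|Real.log n - y| + Real.pi) ^ 2) ≤
      vonMangoldt n / (n : ℝ) ^ σ * fejer 1 (Real.log n - y) +
      vonMangoldt n / (n : ℝ) ^ σ * fejer 1 (Real.log n - (y - Real.pi)) := by
    intro n
    rw [← mul_add]
    refine mul_le_mul_of_nonneg_left ?_ (hw σ n)
    rw [show Real.log n - (y - Real.pi) = Real.log n - y + Real.pi by ring]
    exact inv_abs_add_pi_sq_le _
  have hs := Summable.of_nonneg_of_le (fun n => mul_nonneg (hw σ n) (by positivity)) hle (h1.add h2)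
  refine ⟨hs, (hs.tsum_le_tsum hle (h1.add h2)).trans ?_⟩
  rw [h1.tsum_add h2]
  exact add_le_add (hC σ hσ y) (hC σ hσ _)

/-- On `|v - y| ≤ 1/l`, an interval of length `2/l`, the kernel is at least `l/2`. -/
theorem exp_le_integral_exp_mul_fejer {l σ y : ℝ} (hl : 1 ≤ l) (hσ : 1 < σ) (hy : 1 ≤ y) :
    Real.exp (-(σ - 1) * (y + 1)) ≤ ∫ v in Set.Ioi 0, Real.exp (-(σ - 1) * v) * fejer l (v - y) := by
  have hl0 : 0 < l := by linarith
  have hl1 : 1 / l ≤ 1 := by rw [div_le_one hl0]; exact hl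
  have hint : MeasureTheory.IntegrableOn
      (fun v => Real.exp (-(σ - 1) * v) * fejer l (v - y)) (Set.Ioi 0) := by
    have hw : MeasureTheory.IntegrableOn (fun v : ℝ => Real.exp (-(σ - 1) * v)) (Set.Ioi 0) :=
      exp_neg_integrableOn_Ioi 0 (by linarith)
    have := continuous_fejer l
    refine (hw.mul_const l).mono' (Continuous.aestronglyMeasurable (by fun_prop))
      (MeasureTheory.ae_of_all _ fun v => ?_)
    rw [norm_mul, Real.norm_of_nonneg (Real.exp_nonneg _),
      Real.norm_of_nonneg (fejer_nonneg hl0.le _)]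
    gcongr
    exact fejer_le hl0.le _
  have hsub : Set.Ioc (y - 1 / l) (y + 1 / l) ⊆ Set.Ioi 0 := fun v hv => by
    have := hv.1
    simp only [Set.mem_Ioi]
    linarith
  calc Real.exp (-(σ - 1) * (y + 1))
      = ∫ _ in Set.Ioc (y - 1 / l) (y + 1 / l), Real.exp (-(σ - 1) * (y + 1)) * (l / 2) := by
        rw [MeasureTheory.setIntegral_const, Real.volume_real_Ioc_of_le (by
          have : 0 < 1 / l := by positivity
          linarith), smul_eq_mul]
        field_simp
        ring
    _ ≤ ∫ v in Set.Ioc (y - 1 / l) (y + 1 / l), Real.exp (-(σ - 1) * v) * fejer l (v - y) := by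
        refine MeasureTheory.setIntegral_mono_on (continuous_const.integrableOn_Ioc)
          (hint.mono_set hsub) measurableSet_Ioc fun v hv => ?_
        refine mul_le_mul (Real.exp_le_exp.2 ?_) (half_le_fejer hl0 ?_) (by positivity)
          (Real.exp_nonneg _)
        · nlinarith [hv.2]
        · rw [← le_div_iff₀' hl0, abs_le]
          constructor <;> linarith [hv.1, hv.2]
    _ ≤ _ := MeasureTheory.setIntegral_mono_set hint
        (MeasureTheory.ae_of_all _ fun v => mul_nonneg (Real.exp_nonneg _) (fejer_nonneg hl0.le _))
        (MeasureTheory.ae_of_all _ hsub)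

theorem fejer_le_of_le_abs {l u ε : ℝ} (hl : 0 < l) (hε : 0 < ε) (hu : ε ≤ |u|) :
    fejer l u ≤ 4 * ((ε + Real.pi) / ε) ^ 2 / l * (1 / (|u| + Real.pi) ^ 2) := by
  have hpi := Real.pi_pos
  have hu0 : 0 < |u| := hε.trans_le hu
  refine (fejer_le_div hl (abs_pos.1 hu0)).trans ?_
  have h1 : (|u| + Real.pi) * ε ≤ (ε + Real.pi) * |u| := by nlinarith
  have h2 : ((|u| + Real.pi) * ε) ^ 2 ≤ ((ε + Real.pi) * |u|) ^ 2 := by gcongr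
  have h3 : 4 * ((ε + Real.pi) / ε) ^ 2 / l * (1 / (|u| + Real.pi) ^ 2) =
      4 * (ε + Real.pi) ^ 2 / (l * ((|u| + Real.pi) * ε) ^ 2) := by
    field_simp
  rw [h3, ← sq_abs u, div_le_div_iff₀ (by positivity) (by positivity)]
  calc 4 * (l * ((|u| + Real.pi) * ε) ^ 2) ≤ 4 * (l * ((ε + Real.pi) * |u|) ^ 2) := by gcongr
    _ = _ := by ring

/-! ### Primes in short multiplicative intervals -/

/-- The non-prime part of the von Mangoldt function, divided by `n`. -/
noncomputable def nonPrimePart (n : ℕ) : ℝ := (if n.Prime then 0 else vonMangoldt n) / n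

theorem nonPrimePart_nonneg (n : ℕ) : 0 ≤ nonPrimePart n := by
  unfold nonPrimePart
  split_ifs
  · simp
  · exact div_nonneg ArithmeticFunction.vonMangoldt_nonneg (Nat.cast_nonneg n)

theorem summable_nonPrimePart : Summable nonPrimePart := by
  have h := ArithmeticFunction.vonMangoldt.summable_residueClass_non_primes_div (1 : ZMod 1)
  simp only [residueClass_one_eq] at h
  exact h

theorem exists_tsum_indicator_nonPrimePart_le {η : ℝ} (hη : 0 < η) :
    ∃ N : ℕ, ∑' n, Set.indicator {n | N ≤ n} nonPrimePart n ≤ η := by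
  have h := (tendsto_sum_nat_add nonPrimePart).eventually_le_const hη
  obtain ⟨N, hN⟩ := h.exists
  refine ⟨N, ?_⟩
  have h1 := (summable_nonPrimePart.indicator {n | N ≤ n}).sum_add_tsum_nat_add N
  rw [← h1, Finset.sum_eq_zero, zero_add]
  · simpa using hN
  · intro n hn
    exact Set.indicator_of_notMem (by simpa using hn) _

/-- For every `ε > 0` and all large `y` there is a prime `p` with `|log p - y| < ε`. -/
theorem eventually_exists_prime_log {ε : ℝ} (hε : 0 < ε) :
    ∀ᶠ y in atTop, ∃ p : ℕ, p.Prime ∧ |Real.log p - y| < ε := by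
  obtain ⟨C, hC0, hC⟩ := exists_tsum_inv_sq_le
  set K := 4 * ((ε + Real.pi) / ε) ^ 2 with hK
  have hK0 : 0 ≤ K := by positivity
  -- The choice makes the tail bound `K * C / l` at most `1/4`; with `η = 1/(4l)` the prime powers
  -- contribute at most another `1/4`.
  set l := 4 * (K * C) + 1 with hl
  have hl1 : 1 ≤ l := by nlinarith [mul_nonneg hK0 hC0]
  have hl0 : 0 < l := by linarith
  obtain ⟨N, hN⟩ := exists_tsum_indicator_nonPrimePart_le (η := 1 / (4 * l)) (by positivity)
  have hR := (tendsto_smoothedAux_atTop hl0).norm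
  rw [norm_zero] at hR
  filter_upwards [hR.eventually_lt_const (show (0 : ℝ) < 1 / 4 by norm_num), eventually_ge_atTop 1,
    eventually_ge_atTop (Real.log N + ε)] with y hy hy1 hyN
  by_contra! hgap
  -- Without primes near `e^y`, a term with `|log n - y| < ε` belongs to the non-prime part, and `n
  -- ≥ N` by the choice of `y`; every other term lies in the tail.
  have hpt : ∀ σ ∈ Set.Ioc (1 : ℝ) 2, ∀ n : ℕ,
      vonMangoldt n / (n : ℝ) ^ σ * fejer l (Real.log n - y) ≤
        l * Set.indicator {n | N ≤ n} nonPrimePart n +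
        K / l * (vonMangoldt n / (n : ℝ) ^ σ * (1 / (|Real.log n - y| + Real.pi) ^ 2)) := by
    intro σ hσ n
    have hw : 0 ≤ vonMangoldt n / (n : ℝ) ^ σ :=
      div_nonneg ArithmeticFunction.vonMangoldt_nonneg (by positivity)
    have hind : 0 ≤ Set.indicator {n | N ≤ n} nonPrimePart n :=
      Set.indicator_nonneg (fun n _ => nonPrimePart_nonneg n) n
    rcases lt_or_ge |Real.log n - y| ε with h | h
    · refine le_add_of_le_of_nonneg ?_ (by positivity)
      rcases Nat.eq_zero_or_pos n with rfl | hn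
      · simp only [ArithmeticFunction.map_zero, zero_div, zero_mul]
        positivity
      have hn1 : (1 : ℝ) ≤ n := by exact_mod_cast hn
      have hNn : N ≤ n := by
        rcases Nat.eq_zero_or_pos N with rfl | hN0
        · exact Nat.zero_le _
        have h1 := (abs_lt.1 h).1
        have h2 : Real.log N ≤ Real.log n := by linarith
        exact_mod_cast (Real.log_le_log_iff (by exact_mod_cast hN0) (by linarith)).1 h2
      rw [Set.indicator_of_mem (show n ∈ {n | N ≤ n} from hNn), nonPrimePart,
        if_neg (fun hp => (hgap n hp).not_gt h), mul_comm l]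
      refine mul_le_mul ?_ (fejer_le hl0.le _) (fejer_nonneg hl0.le _)
        (div_nonneg ArithmeticFunction.vonMangoldt_nonneg (by positivity))
      refine div_le_div_of_nonneg_left ArithmeticFunction.vonMangoldt_nonneg (by linarith) ?_
      exact Real.self_le_rpow_of_one_le hn1 hσ.1.le
    · refine le_add_of_nonneg_of_le (by positivity) ?_
      calc _ ≤ vonMangoldt n / (n : ℝ) ^ σ * (K / l * (1 / (|Real.log n - y| + Real.pi) ^ 2)) :=
            mul_le_mul_of_nonneg_left (fejer_le_of_le_abs hl0 hε h) hw
        _ = _ := by ring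
  have hmain : ∀ σ ∈ Set.Ioc (1 : ℝ) 2,
      Real.exp (-(σ - 1) * (y + 1)) + (smoothedAux l σ y).re ≤ 1 / 2 := by
    intro σ hσ
    obtain ⟨hs, hb⟩ := hC σ hσ y
    have hs1 := (summable_nonPrimePart.indicator {n | N ≤ n}).mul_left l
    have hs2 := hs.mul_left (K / l)
    have h1 := (summable_vonMangoldt_mul_fejer hl0 hσ.1 y).tsum_le_tsum (hpt σ hσ) (hs1.add hs2)
    rw [hs1.tsum_add hs2, tsum_mul_left, tsum_mul_left,
      tsum_sub_integral_eq_smoothedAux hl0 hσ.1] at h1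
    have h2 := exp_le_integral_exp_mul_fejer hl1 hσ.1 hy1
    have h3 : l * ∑' n, Set.indicator {n | N ≤ n} nonPrimePart n ≤ 1 / 4 := by
      calc _ ≤ l * (1 / (4 * l)) := by gcongr
        _ = 1 / 4 := by field_simp
    have h4 : K / l * ∑' n : ℕ, (vonMangoldt n / (n : ℝ) ^ σ *
        (1 / (|Real.log n - y| + Real.pi) ^ 2)) ≤ 1 / 4 := by
      calc _ ≤ K / l * C := by gcongr
        _ ≤ 1 / 4 := by
          rw [div_mul_eq_mul_div, div_le_iff₀ hl0]
          linarith
    linarith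
  -- Letting `σ → 1` in `hmain` gives `1 + re ≤ 1/2`, whereas `re ≥ -1/4`.
  have hlim : Tendsto (fun σ : ℝ => Real.exp (-(σ - 1) * (y + 1)) + (smoothedAux l σ y).re)
      (𝓝[>] 1) (𝓝 (1 + (smoothedAux l 1 y).re)) := by
    refine Tendsto.add ?_ ((Complex.continuous_re.tendsto _).comp (tendsto_smoothedAux_one hl0 y))
    refine Tendsto.mono_left ?_ nhdsWithin_le_nhds
    have : Continuous fun σ : ℝ => Real.exp (-(σ - 1) * (y + 1)) := by fun_prop
    simpa using this.tendsto 1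
  have hfin := le_of_tendsto hlim (by
    filter_upwards [Ioc_mem_nhdsGT (one_lt_two (α := ℝ))] with σ hσ using hmain σ hσ)
  have := (abs_le.1 ((Complex.abs_re_le_norm _).trans hy.le)).1
  linarith

/-- For every `ε > 0` and all large `x` there is a prime in `[x, (1 + ε) x]`. -/
theorem eventually_exists_prime_between {ε : ℝ} (hε : 0 < ε) :
    ∀ᶠ x : ℝ in atTop, ∃ p : ℕ, p.Prime ∧ x ≤ p ∧ p ≤ (1 + ε) * x := by
  have hlog : 0 < Real.log (1 + ε) := Real.log_pos (by linarith)
  have h := eventually_exists_prime_log (half_pos hlog)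
  have h2 := (tendsto_atTop_add_const_right atTop (Real.log (1 + ε) / 2)
    Real.tendsto_log_atTop).eventually h
  filter_upwards [h2, eventually_gt_atTop 0] with x hx hx0
  obtain ⟨p, hp, hpx⟩ := hx
  have hp0 : (0 : ℝ) < p := by exact_mod_cast hp.pos
  rw [abs_lt] at hpx
  refine ⟨p, hp, ?_, ?_⟩
  · rw [← Real.log_le_log_iff hx0 hp0]
    linarith
  · rw [← Real.log_le_log_iff hp0 (by positivity), Real.log_mul (by positivity) hx0.ne']
    linarith

/-! ### Recursion on the exponent and the asymptotics -/

/-- `f(r, C₄) = O(r ^ α)`, in terms of explicit graphs. -/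
def PartsBound (α : ℝ) : Prop :=
  ∃ C : ℝ, 0 ≤ C ∧ ∀ r : ℕ, 1 ≤ r →
    ∃ k : ℕ, 1 ≤ k ∧ HasJoinedBlocks (Fin r) (Fin k) ∧ (k : ℝ) ≤ C * (r : ℝ) ^ α

theorem partsBound_one : PartsBound 1 :=
  ⟨1, zero_le_one, fun r hr => ⟨r, hr, hasJoinedBlocks_self _, by simp⟩⟩

theorem cube_rpow_third {r : ℝ} (hr : 0 ≤ r) : (r ^ (1 / 3 : ℝ)) ^ 3 = r := by
  rw [← Real.rpow_natCast, ← Real.rpow_mul hr]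
  norm_num

/-- Recursion along a prime `p` with `r ≤ p ^ 3`. -/
theorem exists_hasJoinedBlocks_of_prime {α C : ℝ}
    (hC : ∀ r : ℕ, 1 ≤ r →
      ∃ k : ℕ, 1 ≤ k ∧ HasJoinedBlocks (Fin r) (Fin k) ∧ (k : ℝ) ≤ C * (r : ℝ) ^ α)
    {p r : ℕ} (hp : p.Prime) (hp2 : p ≠ 2) (hr : (r : ℝ) ^ (1 / 3 : ℝ) ≤ p) :
    ∃ k : ℕ, HasJoinedBlocks (Fin r) (Fin (p + k)) ∧ (k : ℝ) ≤ C * (p : ℝ) ^ (2 * α) := by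
  obtain ⟨k, -, hk, hkC⟩ := hC (p ^ 2) (Nat.one_le_pow _ _ hp.pos)
  refine ⟨k, (hk.prime_cube hp hp2).mono ?_, ?_⟩
  · have : (r : ℝ) ≤ (p : ℝ) ^ 3 := by
      rw [← cube_rpow_third r.cast_nonneg]
      gcongr
    exact_mod_cast this
  · rwa [Nat.cast_pow, ← Real.rpow_natCast, ← Real.rpow_mul p.cast_nonneg, Nat.cast_ofNat] at hkC

/-- With `p ≤ 2 r^(1/3)`, the cost is `p + C p^(2α)`; `α ≥ 1/2` makes the second exponent dominate.
For bounded `r` the matching is used, at a cost absorbed by `X ^ 3`. -/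
theorem PartsBound.step {α : ℝ} (h : PartsBound α) (hα : 1 / 2 ≤ α) : PartsBound (2 * α / 3) := by
  obtain ⟨C, hC0, hC⟩ := h
  obtain ⟨x₀, hx₀⟩ := eventually_atTop.1 (eventually_exists_prime_between one_pos)
  set X := max x₀ 3 with hX
  have hX3 : 3 ≤ X := le_max_right _ _
  refine ⟨2 + C * 2 ^ (2 * α) + X ^ 3, by positivity, fun r hr => ?_⟩
  have hr1 : (1 : ℝ) ≤ r := by exact_mod_cast hr
  have hr0 : (0 : ℝ) ≤ r := by linarith
  have hpow : 1 ≤ (r : ℝ) ^ (2 * α / 3) := Real.one_le_rpow hr1 (by linarith)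
  rcases le_or_gt X ((r : ℝ) ^ (1 / 3 : ℝ)) with hlarge | hsmall
  · obtain ⟨p, hp, hp1, hp2⟩ := hx₀ _ ((le_max_left _ _).trans hlarge)
    have hp3 : (3 : ℝ) ≤ p := by linarith
    have hp3' : 3 ≤ p := by exact_mod_cast hp3
    obtain ⟨k, hk, hkC⟩ := exists_hasJoinedBlocks_of_prime hC hp (by omega) hp1
    refine ⟨p + k, by omega, hk, ?_⟩
    have h1 : (r : ℝ) ^ (1 / 3 : ℝ) ≤ (r : ℝ) ^ (2 * α / 3) :=
      Real.rpow_le_rpow_of_exponent_le hr1 (by linarith)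
    have h2 : (p : ℝ) ^ (2 * α) ≤ 2 ^ (2 * α) * (r : ℝ) ^ (2 * α / 3) := by
      calc (p : ℝ) ^ (2 * α) ≤ (2 * (r : ℝ) ^ (1 / 3 : ℝ)) ^ (2 * α) :=
            Real.rpow_le_rpow p.cast_nonneg (by linarith) (by linarith)
        _ = _ := by
            rw [Real.mul_rpow zero_le_two (by positivity), ← Real.rpow_mul hr0]
            congr 2
            ring
    have h3 : C * (p : ℝ) ^ (2 * α) ≤ C * (2 ^ (2 * α) * (r : ℝ) ^ (2 * α / 3)) := by gcongr
    have h4 : 0 ≤ X ^ 3 * (r : ℝ) ^ (2 * α / 3) := by positivity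
    push_cast
    linarith
  · refine ⟨r, hr, hasJoinedBlocks_self _, ?_⟩
    have h1 : (r : ℝ) ≤ X ^ 3 := by
      rw [← cube_rpow_third hr0]
      gcongr
    have h2 : 0 ≤ C * (2 : ℝ) ^ (2 * α) := by positivity
    calc (r : ℝ) ≤ X ^ 3 * 1 := by linarith
      _ ≤ _ := by
        gcongr
        linarith

theorem tendsto_natCast_rpow_third :
    Tendsto (fun r : ℕ => (r : ℝ) ^ (1 / 3 : ℝ)) atTop atTop :=
  (tendsto_rpow_atTop (by norm_num)).comp tendsto_natCast_atTop_atTop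

theorem eventually_exists_le_mul_rpow_third {ε : ℝ} (hε : 0 < ε) :
    ∀ᶠ r : ℕ in atTop, ∃ k ∈ freePartSizes r (SimpleGraph.cycleGraph 4),
      (k : ℝ) ≤ (1 + ε) * (r : ℝ) ^ (1 / 3 : ℝ) := by
  -- The exponents run `1 → 2/3 → 4/9`; two rounds suffice because `2 * 4/9 < 1`.
  have hP : PartsBound (2 * (2 * 1 / 3) / 3) :=
    (partsBound_one.step (by norm_num)).step (by norm_num)
  obtain ⟨C, hC0, hC⟩ := hP
  set δ := ε / 2 with hδ
  have hδ0 : 0 < δ := half_pos hε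
  have hlim : Tendsto (fun x : ℝ => x ^ (1 / 9 : ℝ)) atTop atTop := tendsto_rpow_atTop (by norm_num)
  filter_upwards [tendsto_natCast_rpow_third.eventually (eventually_exists_prime_between hδ0),
    tendsto_natCast_rpow_third.eventually (eventually_ge_atTop 3),
    tendsto_natCast_rpow_third.eventually
      (hlim.eventually (eventually_ge_atTop (C * (1 + δ) ^ (8 / 9 : ℝ) / δ)))] with r hr h3 hbig
  obtain ⟨p, hp, hp1, hp2⟩ := hr
  have hp3 : 3 ≤ p := by exact_mod_cast h3.trans hp1
  obtain ⟨k, hk, hkC⟩ := exists_hasJoinedBlocks_of_prime hC hp (by omega) hp1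
  refine ⟨p + k, mem_freePartSizes_of_hasJoinedBlocks (by omega) hk, ?_⟩
  set s := (r : ℝ) ^ (1 / 3 : ℝ) with hs
  have hs0 : 0 < s := by linarith
  have h1 : (p : ℝ) ^ (2 * (2 * (2 * 1 / 3) / 3) : ℝ) ≤ (1 + δ) ^ (8 / 9 : ℝ) * s ^ (8 / 9 : ℝ) := by
    rw [← Real.mul_rpow (by positivity) hs0.le]
    norm_num
    exact Real.rpow_le_rpow p.cast_nonneg hp2 (by norm_num)
  have h2 : s = s ^ (1 / 9 : ℝ) * s ^ (8 / 9 : ℝ) := by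
    rw [← Real.rpow_add hs0]
    norm_num
  rw [div_le_iff₀ hδ0] at hbig
  have h4 : (k : ℝ) ≤ δ * s := by
    calc (k : ℝ) ≤ C * ((1 + δ) ^ (8 / 9 : ℝ) * s ^ (8 / 9 : ℝ)) := hkC.trans (by gcongr)
      _ = C * (1 + δ) ^ (8 / 9 : ℝ) * s ^ (8 / 9 : ℝ) := by ring
      _ ≤ s ^ (1 / 9 : ℝ) * δ * s ^ (8 / 9 : ℝ) := by gcongr
      _ = δ * (s ^ (1 / 9 : ℝ) * s ^ (8 / 9 : ℝ)) := by ring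
      _ = δ * s := by rw [← h2]
  push_cast
  have h5 : ε = 2 * δ := by rw [hδ]; ring
  rw [h5]
  linarith

theorem eventually_forall_mul_rpow_third_le {ε : ℝ} (hε : 0 < ε) :
    ∀ᶠ r : ℕ in atTop, ∀ k ∈ freePartSizes r (SimpleGraph.cycleGraph 4),
      (1 - ε) * (r : ℝ) ^ (1 / 3 : ℝ) ≤ k := by
  filter_upwards [tendsto_natCast_rpow_third.eventually (eventually_ge_atTop 2),
    tendsto_natCast_rpow_third.eventually (eventually_gt_atTop (3 / ε)),
    eventually_ge_atTop 1] with r h2 hbig hr1 k hk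
  by_contra! hlt
  obtain ⟨n, D, hn, hD, hnD⟩ := exists_counting_of_mem_freePartSizes hk
  have hr : ((r : ℝ) ^ (1 / 3 : ℝ)) ^ 3 = r := cube_rpow_third r.cast_nonneg
  set s := (r : ℝ) ^ (1 / 3 : ℝ) with hs
  have hs0 : 0 < s := by linarith
  have hε1 : 0 ≤ 1 - ε := by
    by_contra! h
    have : (0 : ℝ) ≤ k := k.cast_nonneg
    nlinarith
  have hn' : (n : ℝ) ≤ (1 - ε) * s ^ 4 := by
    calc (n : ℝ) ≤ r * k := by exact_mod_cast hn
      _ ≤ s ^ 3 * ((1 - ε) * s) := by rw [← hr]; gcongr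
      _ = _ := by ring
  have hD' : s ^ 6 - s ^ 3 ≤ (D : ℝ) := by
    have h : ((r * (r - 1) : ℕ) : ℝ) ≤ D := by exact_mod_cast hD
    rw [Nat.cast_mul, Nat.cast_sub hr1, ← hr] at h
    push_cast at h
    linarith
  have hnD' : (D : ℝ) * (D - n) ≤ (n : ℝ) ^ 3 := by
    have h : (D : ℝ) ^ 2 ≤ n * (n ^ 2 + D) := by exact_mod_cast hnD
    linarith
  have hn0 : (0 : ℝ) ≤ n := n.cast_nonneg
  have hns : (n : ℝ) ≤ s ^ 4 := hn'.trans (mul_le_of_le_one_left (by positivity) (by linarith))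
  have hpos : 0 ≤ s ^ 6 - s ^ 3 - s ^ 4 := by
    have h : s ^ 6 - s ^ 3 - s ^ 4 = s ^ 3 * (s * (s ^ 2 - 1) - 1) := by ring
    rw [h]
    apply mul_nonneg (by positivity)
    nlinarith
  have hT0 : 0 ≤ s ^ 6 - s ^ 3 := by linarith [pow_pos hs0 4]
  have hlow : (s ^ 6 - s ^ 3) * (s ^ 6 - s ^ 3 - s ^ 4) ≤ D * (D - n) :=
    mul_le_mul hD' (by linarith) hpos (by linarith)
  have hup : (n : ℝ) ^ 3 ≤ (1 - ε) * s ^ 12 := by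
    calc (n : ℝ) ^ 3 = n * n ^ 2 := by ring
      _ ≤ ((1 - ε) * s ^ 4) * (s ^ 4) ^ 2 := by gcongr
      _ = _ := by ring
  -- Comparing `hlow` with `hup`, the terms `s ^ 12` cancel up to `ε * s ^ 12`, which lower-order
  -- terms cannot match once `s > 3 / ε`.
  have hfin : ε * s ^ 12 ≤ 3 * s ^ 10 := by
    have h : s ^ 9 ≤ s ^ 10 := pow_le_pow_right₀ (by linarith) (by norm_num)
    have h7 := pow_pos hs0 7
    have h6 := pow_pos hs0 6
    have : (s ^ 6 - s ^ 3) * (s ^ 6 - s ^ 3 - s ^ 4) =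
      s ^ 12 - s ^ 10 - 2 * s ^ 9 + s ^ 7 + s ^ 6 := by ring
    linarith
  rw [div_lt_iff₀ hε] at hbig
  have h10 := pow_pos hs0 10
  have h3 : 3 < ε * s ^ 2 := by nlinarith
  have h12 : ε * s ^ 12 = ε * s ^ 2 * s ^ 10 := by ring
  rw [h12] at hfin
  exact absurd (le_of_mul_le_mul_right hfin h10) (not_le.2 h3)

theorem freePartSizes_nonempty {r : ℕ} (hr : 1 ≤ r) :
    (freePartSizes r (SimpleGraph.cycleGraph 4)).Nonempty :=
  ⟨r, mem_freePartSizes_of_hasJoinedBlocks hr (hasJoinedBlocks_self _)⟩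

theorem corollary2 :
    (∀ r : ℕ, 1 ≤ r →
      IsLeast (freePartSizes r (SimpleGraph.cycleGraph 4))
        (minPartSize r (SimpleGraph.cycleGraph 4))) ∧
    (fun r : ℕ =>
        (minPartSize r (SimpleGraph.cycleGraph 4) : ℝ) - (r : ℝ) ^ (1 / 3 : ℝ))
      =o[atTop] fun r : ℕ => (r : ℝ) ^ (1 / 3 : ℝ) := by
  have hleast : ∀ r : ℕ, 1 ≤ r → IsLeast (freePartSizes r (SimpleGraph.cycleGraph 4))
      (minPartSize r (SimpleGraph.cycleGraph 4)) := fun r hr =>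
    ⟨Nat.sInf_mem (freePartSizes_nonempty hr), fun _ hk => Nat.sInf_le hk⟩
  refine ⟨hleast, isLittleO_iff.2 fun ε hε => ?_⟩
  filter_upwards [eventually_exists_le_mul_rpow_third hε, eventually_forall_mul_rpow_third_le hε,
    eventually_ge_atTop 1] with r ⟨k, hk, hku⟩ hlow hr
  have h1 := hlow _ (hleast r hr).1
  have h2 : (minPartSize r (SimpleGraph.cycleGraph 4) : ℝ) ≤ k := by
    exact_mod_cast (hleast r hr).2 hk
  rw [Real.norm_eq_abs, Real.norm_of_nonneg (by positivity), abs_le]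
  constructor <;> linarith
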